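/- Let $M$ be a smooth manifold. Let $\Phi(\tau_M)=\bigoplus_q\Phi^q(\tau_M)$ and $\Phi(\tau_{TM})=\bigoplus_q\Phi^q(\tau_{TM})$ be the graded exterior algebras of smooth multivector fields on $M$ and on $TM$. For $u\in T_xM$ and $w\in T_xM$ let $u^v_w=\frac{d}{dt}\big|_{t=0}(w+tu)\in T_wTM$ be the vertical lift of $u$ to $w$, and let $\mathrm v_T\colon\Phi(\tau_M)\to\Phi(\tau_{TM})$ be the homomorphism of graded algebras that extends the vertical lift $Y\mapsto Y^v$ of vector fields and is the pull-back along $TM\to M$ on functions, so that $\mathrm v_T(X_1\wedge\dots\wedge X_r)=X_1^v\wedge\dots\wedge X_r^v$. Let $\varepsilon_M\colon T^*TM\to TT^*M$ be the canonical isomorphism, given in the coordinates $(x,\dot x,\pi,\dot\pi)$ of $T^*TM$ and $(x,p,\dot x,\dot p)$ of $TT^*M$ adapted to a chart of $M$ by $(x,p,\dot x,\dot p)\circ\varepsilon_M=(x,\dot\pi,\dot x,\pi)$. An $r$-vector field $X$ on $M$ defines the function $\widetilde X(\beta_1,\dots,\beta_r)=\langle X,\beta_1\wedge\dots\wedge\beta_r\rangle$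 on $T^*M\times_M\dots\times_M T^*M$. Its tangent lift $\mathrm d_TX$ is the $r$-vector field on $TM$ with $$(\mathrm d_TX)(a_1,\dots,a_r)=(\mathrm d\widetilde X)(\varepsilon_Ma_1,\dots,\varepsilon_Ma_r)$$ for all $w\in TM$ and $a_1,\dots,a_r\in T^*_wTM$; for $r=0$ this means that $\mathrm d_Tf$ is the differential of $f$ as a function on $TM$. Extend $\mathrm d_T$ to inhomogeneous multivector fields by linearity. **Theorem 2.3.** The tangent lift $\mathrm d_TX$ exists, is smooth and is uniquely determined for every $X\in\Phi(\tau_M)$, and $\mathrm d_T\colon\Phi(\tau_M)\to\Phi(\tau_{TM})$ is a $\mathrm v_T$-derivation of degree $0$: it is $\mathbb R$-linear, $\mathrm d_T(\Phi^q(\tau_M))\subset\Phi^q(\tau_{TM})$ for all $q$, and $$\mathrm d_T(X\wedge Z)=\mathrm d_TX\wedge \mathrm v_T(Z)+\mathrm v_T(X)\wedge \mathrm d_TZ$$ for all $X,Z\in\Phi(\tau_M)$. For every vector field $Y$ on $M$, $\mathrm d_TY=Y^c$ is the complete lift of $Y$, given in the coordinates $(x,\dot x)$ of $TM$ adapted to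 a chart of $M$ by $$Y^c=Y^i\frac{\partial}{\partial x^i}+\frac{\partial Y^i}{\partial x^k}\,\dot x^k\frac{\partial}{\partial\dot x^i}.$$ -/

import Mathlib

open Bundle Set
open scoped Manifold ContDiff

namespace Multivector

/-- `a : A → B` is a `ρ`-derivation of degree `r`, where `𝒜`, `ℬ` are the gradings of the algebras
`A`, `B`, and `ρ : A → B` is a homomorphism of graded algebras (`hom_mem`): `a` is linear, it raises
degrees by `r`, and `a (μ ∧ ν) = a μ ∧ ρ ν + (-1) ^ (q r) ρ μ ∧ a ν` for `μ` of degree `q`. -/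
structure IsDerivationAlong {A B : Type*} [Ring A] [Algebra ℝ A] [Ring B] [Algebra ℝ B]
    (𝒜 : ℕ → Submodule ℝ A) (ℬ : ℕ → Submodule ℝ B) (ρ : A →ₐ[ℝ] B) (r : ℕ)
    (a : A →ₗ[ℝ] B) : Prop where
  hom_mem : ∀ q, ∀ μ ∈ 𝒜 q, ρ μ ∈ ℬ q
  mem : ∀ q, ∀ μ ∈ 𝒜 q, a μ ∈ ℬ (q + r)
  leibniz : ∀ q, ∀ μ ∈ 𝒜 q, ∀ ν : A, a (μ * ν) = a μ * ρ ν + (-1 : ℝ) ^ (q * r) • (ρ μ * a ν)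

/-- Finite-dimensionality of the exterior algebra. -/
instance finite_exteriorAlgebra {V : Type*} [AddCommGroup V] [Module ℝ V] [FiniteDimensional ℝ V] :
    FiniteDimensional ℝ (ExteriorAlgebra ℝ V) :=
  Module.Finite.of_basis (Module.finBasis ℝ V).ExteriorAlgebra

/-- The coefficient of `e₁ ∧ ⋯ ∧ e_r` of an element of the exterior algebra of `ℝ^r`: the linear map
which sends `v₁ ∧ ⋯ ∧ v_r` to the determinant of the `v_i`, and vanishes in all degrees but `r`. -/
noncomputable def topCoeff (r : ℕ) : ExteriorAlgebra ℝ (Fin r → ℝ) →ₗ[ℝ] ℝ :=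
  ExteriorAlgebra.liftAlternating (Pi.single r Matrix.detRowAlternating)

/-- An `r`-tuple of covectors `β = (β₁, …, β_r)` on `V` is a linear map `V → ℝ^r`. `pairing β` is the
canonical pairing `⟨X, β₁ ∧ ⋯ ∧ β_r⟩` with multivectors `X`: it sends `v₁ ∧ ⋯ ∧ v_r` to
`det (β_i (v_j))` and vanishes in all degrees but `r`. -/
noncomputable def pairing {V : Type*} [AddCommGroup V] [Module ℝ V] [TopologicalSpace V]
    {r : ℕ} (β : V →L[ℝ] (Fin r → ℝ)) : ExteriorAlgebra ℝ V →ₗ[ℝ] ℝ :=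
  topCoeff r ∘ₗ (ExteriorAlgebra.map β.toLinearMap).toLinearMap

section General

variable {E : Type*} [NormedAddCommGroup E] [NormedSpace ℝ E]
  {H : Type*} [TopologicalSpace H] (I : ModelWithCorners ℝ E H)
  {M : Type*} [TopologicalSpace M] [ChartedSpace H M] [IsManifold I ∞ M]

/-- The isomorphism `⋀ T_x M → ⋀ E` given by the coordinate frame of the preferred chart at `x₀`
(for `x` in the domain of that chart). -/
noncomputable def coords (x₀ x : M) :
    ExteriorAlgebra ℝ (TangentSpace I x) →ₐ[ℝ] ExteriorAlgebra ℝ E :=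
  ExteriorAlgebra.map
    ((trivializationAt E (TangentSpace I : M → Type _) x₀).continuousLinearMapAt ℝ x).toLinearMap

/-- Smoothness of a section of `⋀ TM`: its coefficients in the frames of `⋀ TM` induced by charts are
smooth functions. -/
def IsSmooth (s : ∀ x : M, ExteriorAlgebra ℝ (TangentSpace I x)) : Prop :=
  ∀ (x₀ : M) (ℓ : ExteriorAlgebra ℝ E →ₗ[ℝ] ℝ),
    ContMDiffAt I 𝓘(ℝ, ℝ) ∞ (fun x => ℓ (coords I x₀ x (s x))) x₀

variable {I} in
theorem IsSmooth.mul [FiniteDimensional ℝ E] {s t : ∀ x : M, ExteriorAlgebra ℝ (TangentSpace I x)}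
    (hs : IsSmooth I s) (ht : IsSmooth I t) : IsSmooth I (s * t) := by
  intro x₀ ℓ
  let b := Module.finBasis ℝ (ExteriorAlgebra ℝ E)
  have key : ∀ x, ℓ (coords I x₀ x ((s * t) x)) =
      ∑ i, ∑ j, b.coord i (coords I x₀ x (s x)) * b.coord j (coords I x₀ x (t x)) *
        ℓ (b i * b j) := by
    intro x
    rw [Pi.mul_apply, map_mul]
    conv_lhs => rw [← b.sum_repr (coords I x₀ x (s x)), ← b.sum_repr (coords I x₀ x (t x))]
    simp only [Finset.sum_mul_sum, map_sum, smul_mul_smul_comm, map_smul, smul_eq_mul,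
      Module.Basis.coord_apply]
  simp only [key]
  exact ContMDiffAt.sum fun i _ => ContMDiffAt.sum fun j _ =>
    ((hs x₀ _).mul (ht x₀ _)).mul contMDiffAt_const

variable (M) in
/-- The exterior algebra `Φ(τ_M)` of multivector fields on `M`: smooth sections of `⋀ TM`, with the
pointwise wedge product as multiplication. -/
noncomputable def MultivectorField [FiniteDimensional ℝ E] :
    Subalgebra ℝ (∀ x : M, ExteriorAlgebra ℝ (TangentSpace I x)) where
  carrier := {s | IsSmooth I s}
  mul_mem' hs ht := hs.mul ht
  add_mem' {s t} hs ht x₀ ℓ := by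
    have h := (hs x₀ ℓ).add (ht x₀ ℓ)
    refine h.congr_of_eventuallyEq (Filter.Eventually.of_forall fun x => ?_)
    simp
  algebraMap_mem' c x₀ ℓ := by
    simpa [AlgHom.commutes] using contMDiffAt_const

variable (M) in
/-- The space `Φ^q(τ_M)` of `q`-vector fields, the part of degree `q` of `Φ(τ_M)`. -/
noncomputable def multivectorDegree [FiniteDimensional ℝ E] (q : ℕ) :
    Submodule ℝ (MultivectorField I M) where
  carrier := {s | ∀ x, s.1 x ∈ ⋀[ℝ]^q (TangentSpace I x)}
  add_mem' hs ht x := add_mem (hs x) (ht x)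
  zero_mem' _ := zero_mem _
  smul_mem' c _ hs x := Submodule.smul_mem _ c (hs x)

/-- A smooth vector field, as a multivector field of degree `1`. -/
noncomputable def ofVectorField [FiniteDimensional ℝ E]
    (Y : Cₛ^∞⟮I; E, (TangentSpace I : M → Type _)⟯) :
    MultivectorField I M :=
  ⟨fun x => ExteriorAlgebra.ι ℝ (Y x), by
    intro x₀ ℓ
    have h := (contMDiffAt_section (n := ∞) (F := E) (IB := I) (E := (TangentSpace I : M → Type _)) (s := fun x => Y x)
      x₀).1 (Y.contMDiff x₀)
    have h2 := (ContinuousLinearMap.contMDiff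
      (LinearMap.toContinuousLinearMap (ℓ ∘ₗ ExteriorAlgebra.ι ℝ (M := E))) (n := ∞)).contMDiffAt.comp x₀ h
    refine h2.congr_of_eventuallyEq ?_
    have hx : ∀ᶠ x in nhds x₀, x ∈ (trivializationAt E (TangentSpace I : M → Type _) x₀).baseSet :=
      (trivializationAt E (TangentSpace I : M → Type _) x₀).open_baseSet.mem_nhds
        (mem_baseSet_trivializationAt _ _ _)
    filter_upwards [hx] with x hx
    simp [coords, Trivialization.coe_linearMapAt_of_mem _ hx]⟩

/-- The vertical lift `T_x M → T_w TM` at `w ∈ T_x M`, that is `u ↦ d/dt (w + t u)` at `t = 0` (see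
`hasMFDerivAt_vert`). In the coordinates `(x, ẋ)` of `TM` adapted to the preferred chart at `x`,
which are those of the preferred chart of `TM` at `w`, it sends `∂/∂xⁱ` to `∂/∂ẋⁱ`. -/
noncomputable def vert (w : TangentBundle I M) :
    TangentSpace I w.1 →L[ℝ] TangentSpace I.tangent w :=
  ContinuousLinearMap.inr ℝ E E

/-- The map `∂/∂xⁱ ↦ ∂/∂xⁱ` from `T_x M` to `T_w TM`, in the coordinates `(x, ẋ)` of `TM` adapted to
the preferred chart at `x`, the base point of `w`. It depends on that chart, and is used only for
writing objects of `TM` in coordinates. -/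
noncomputable def horiz (w : TangentBundle I M) :
    TangentSpace I w.1 →L[ℝ] TangentSpace I.tangent w :=
  ContinuousLinearMap.inl ℝ E E

/-- The vertical lift is the derivative of the inclusion of the fibre. -/
theorem hasMFDerivAt_vert (x : M) (v : E) :
    HasMFDerivAt 𝓘(ℝ, E) I.tangent
      (fun u : E => (⟨x, u⟩ : TangentBundle I M)) v (vert I (⟨x, v⟩ : TangentBundle I M)) := by
  refine ⟨(FiberBundle.continuous_totalSpaceMk E (TangentSpace I : M → Type _) x).continuousAt, ?_⟩
  have h : writtenInExtChartAt 𝓘(ℝ, E) I.tangent v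
      (fun u : E => (⟨x, u⟩ : TangentBundle I M)) =
      fun u : E => (extChartAt I x x, u) := by
    funext u
    have := tangentCoordChange_self (I := I) (x := x) (z := x) (v := u)
      (mem_extChartAt_source x)
    simp only [tangentCoordChange_def] at this
    simp only [writtenInExtChartAt, FiberBundle.extChartAt, extChartAt_model_space_eq_id]
    exact Prod.ext rfl this
  rw [h]
  exact ((hasFDerivAt_const (extChartAt I x x) v).prodMk
    (hasFDerivAt_id v)).hasFDerivWithinAt

/-- The vertical lift in the coordinates of an arbitrary preferred chart of `TM`. -/
theorem coords_vert (w₀ w : TangentBundle I M) (hw : w.1 ∈ (chartAt H w₀.1).source) (u : TangentSpace I w.1) :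
  (trivializationAt (E × E) (TangentSpace I.tangent : TangentBundle I M → Type _) w₀).continuousLinearMapAt ℝ w (vert I w u)
   = ((0 : E), (trivializationAt E (TangentSpace I : M → Type _) w₀.1).continuousLinearMapAt ℝ w.1 u) := by
  have hw' : w ∈ (chartAt (ModelProd H E) w₀).source := by
    simpa using hw
  have e := TangentBundle.continuousLinearMapAt_trivializationAt (I := I.tangent) hw'
  have h1 : HasMFDerivAt I.tangent 𝓘(ℝ, E × E) (extChartAt I.tangent w₀) w
      (mfderiv I.tangent 𝓘(ℝ, E × E) (extChartAt I.tangent w₀) w) :=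
    (mdifferentiableAt_extChartAt hw').hasMFDerivAt
  obtain ⟨x, v⟩ := w
  change E at v
  have h2 := HasMFDerivAt.comp (f := fun u : E => (⟨x, u⟩ : TangentBundle I M)) v h1
    (hasMFDerivAt_vert I x v)
  let L : E →L[ℝ] E :=
    (trivializationAt E (TangentSpace I : M → Type _) w₀.1).continuousLinearMapAt ℝ x
  have h3 : (extChartAt I.tangent w₀ ∘ fun u : E => (⟨x, u⟩ : TangentBundle I M)) =
      fun u : E => (extChartAt I w₀.1 x, L u) := by
    funext u
    have hb : x ∈ (trivializationAt E (TangentSpace I : M → Type _) w₀.1).baseSet := hw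
    simp only [FiberBundle.extChartAt, Function.comp]
    refine Prod.ext rfl ?_
    exact (congrFun (Trivialization.coe_linearMapAt_of_mem (R := ℝ) _ hb) u).symm
  rw [h3] at h2
  have h4 : HasFDerivAt (fun u : E => (extChartAt I w₀.1 x, L u))
      ((0 : E →L[ℝ] E).prod L) v :=
    (hasFDerivAt_const _ _).prodMk L.hasFDerivAt
  have h5 := hasMFDerivAt_unique h2 h4.hasMFDerivAt
  rw [e]
  exact congrArg (fun T : E →L[ℝ] E × E => T u) h5

/-- The vertical lift `v_T : Φ(τ_M) → Φ(τ_TM)`: the homomorphism of algebras that extends the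
vertical lift of vector fields, `v_T (X₁ ∧ ⋯ ∧ X_r) = X₁ᵛ ∧ ⋯ ∧ X_rᵛ`, and is the pull-back along
`TM → M` on functions. -/
noncomputable def verticalLift [FiniteDimensional ℝ E] :
    MultivectorField I M →ₐ[ℝ] MultivectorField I.tangent (TangentBundle I M) where
  toFun X := ⟨fun w => ExteriorAlgebra.map (vert I w).toLinearMap (X.1 w.1), by
    intro w₀ ℓ
    have h := X.2 w₀.1 (ℓ ∘ₗ (ExteriorAlgebra.map (LinearMap.inr ℝ E E)).toLinearMap)
    have h2 := h.comp w₀ (contMDiff_proj (TangentSpace I : M → Type _) w₀)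
    refine h2.congr_of_eventuallyEq ?_
    have hx : ∀ᶠ w : TangentBundle I M in nhds w₀, w.1 ∈ (chartAt H w₀.1).source :=
      (FiberBundle.continuous_proj E (TangentSpace I : M → Type _)).continuousAt.eventually
        ((chartAt H w₀.1).open_source.mem_nhds (mem_chart_source H w₀.1))
    filter_upwards [hx] with w hw
    have key : ((trivializationAt (E × E) (TangentSpace I.tangent : TangentBundle I M → Type _)
        w₀).continuousLinearMapAt ℝ w).toLinearMap ∘ₗ (vert I w).toLinearMap =
        LinearMap.inr ℝ E E ∘ₗ ((trivializationAt E (TangentSpace I : M → Type _)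
          w₀.1).continuousLinearMapAt ℝ w.1).toLinearMap :=
      LinearMap.ext fun u => coords_vert I w₀ w hw u
    have key2 : (coords I.tangent w₀ w).comp (ExteriorAlgebra.map (vert I w).toLinearMap) =
        (ExteriorAlgebra.map (LinearMap.inr ℝ E E)).comp (coords I w₀.1 w.1) := by
      simp only [coords, ExteriorAlgebra.map_comp_map, key]
    exact congrArg ℓ (DFunLike.congr_fun key2 (X.1 w.1))⟩
  map_one' := by ext w; simp
  map_mul' X Y := by ext w; simp
  map_zero' := by ext w; simp
  map_add' X Y := by ext w; simp
  commutes' c := by ext w; simp 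

variable (M) in
/-- The manifold `T*M ×_M ⋯ ×_M T*M` (`r` factors), the total space of the vector bundle
`Hom (TM, ℝ^r)`: a linear map `T_x M → ℝ^r` is an `r`-tuple of covectors at `x`. For `r = 1` it is
`T*M`. -/
abbrev CovectorTuples (r : ℕ) : Type _ :=
  TotalSpace (E →L[ℝ] (Fin r → ℝ))
    (fun x : M => TangentSpace I x →L[ℝ] Bundle.Trivial M (Fin r → ℝ) x)

/-- The function `(β₁, …, β_r) ↦ ⟨X, β₁ ∧ ⋯ ∧ β_r⟩` on `T*M ×_M ⋯ ×_M T*M` defined by the part of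
degree `r` of a multivector field `X`. -/
noncomputable def contraction [FiniteDimensional ℝ E] (r : ℕ) (X : MultivectorField I M)
    (p : CovectorTuples I M r) : ℝ :=
  pairing p.2 (X.1 p.1)

/-- The point of `T*M ×_M ⋯ ×_M T*M` over which `epsilon` lies; see there. -/
noncomputable def epsilonBase {r : ℕ} {w : TangentBundle I M}
    (A : TangentSpace I.tangent w →L[ℝ] (Fin r → ℝ)) :
    CovectorTuples I M r := ⟨w.1, A ∘L vert I w⟩

/-- The canonical isomorphism `ε : T*TM → TT*M` (the inverse of the dual of the canonical flip of
`TTM`), applied to each entry of an `r`-tuple `A = (a₁, …, a_r)` of covectors at `w ∈ TM`.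
In the coordinates `(x, ẋ, π, π̇)` of `T*TM` and `(x, p, ẋ, ṗ)` of `TT*M` adapted to a chart of `M`, it
is given by `(x, p, ẋ, ṗ) ∘ ε = (x, π̇, ẋ, π)`. The `r` tangent vectors `ε a_i` of `T*M` lie over the
same tangent vector `w` of `M`, and thus form one tangent vector of `T*M ×_M ⋯ ×_M T*M`, at the point
`epsilonBase I A`. The formula uses the preferred chart at the base point of `w`; the preferred charts
of `TM` and of `T*M ×_M ⋯ ×_M T*M`, hence the coordinates on their tangent spaces, are adapted to it. -/
noncomputable def epsilon {r : ℕ} {w : TangentBundle I M}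
    (A : TangentSpace I.tangent w →L[ℝ] (Fin r → ℝ)) :
    TangentSpace (I.prod 𝓘(ℝ, E →L[ℝ] (Fin r → ℝ))) (epsilonBase I A) :=
  ((w.2 : E), (A ∘L horiz I w : E →L[ℝ] (Fin r → ℝ)))

/-- `Z` is the tangent lift `d_T X` of the multivector field `X`: for covectors `a₁, …, a_r` at `w ∈ TM`,
`(d_T X) (a₁, …, a_r) = (d_T X̃) (ε a₁, …, ε a_r)`, where `X̃` is the function that `X` defines on
`T*M ×_M ⋯ ×_M T*M`, and `d_T` of a function is its differential, as a function on the tangent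
bundle. For `r = 0` this says that `d_T f` is the differential of `f`. -/
def IsTangentLift [FiniteDimensional ℝ E] (X : MultivectorField I M)
    (Z : MultivectorField I.tangent (TangentBundle I M)) : Prop :=
  ∀ (r : ℕ) (w : TangentBundle I M) (A : TangentSpace I.tangent w →L[ℝ] (Fin r → ℝ)),
    pairing A (Z.1 w) =
      mfderiv (I.prod 𝓘(ℝ, E →L[ℝ] (Fin r → ℝ))) 𝓘(ℝ, ℝ) (contraction I r X)
        (epsilonBase I A) (epsilon I A)

/-- The complete lift `Yᶜ = Yⁱ ∂/∂xⁱ + (∂Yⁱ/∂xᵏ) ẋᵏ ∂/∂ẋⁱ` of a vector field `Y`, in the coordinates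
`(x, ẋ)` of `TM` adapted to the preferred chart at the base point of `w`. -/
noncomputable def completeLift (Y : Cₛ^∞⟮I; E, (TangentSpace I : M → Type _)⟯)
    (w : TangentBundle I M) : TangentSpace I.tangent w :=
  ((Y w.1 : E),
    (mfderiv I 𝓘(ℝ, E)
      (fun x => (trivializationAt E (TangentSpace I : M → Type _) w.1 ⟨x, Y x⟩).2) w.1 w.2 : E))

end General

end Multivector

/-! On a vector space `V`, let `s_t : V → V × V` be `a ↦ (t a, a)`. The lift at `(y, v)` of a
multivector field `ξ` is the velocity at `t = 0` of the curve `Λ(s_t) ξ(y + t v)` (`flatLift`,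
`hasDerivAt_sprout_line`). Most properties are read off from this curve. Each `Λ(s_t)` is a graded
algebra homomorphism and `s_0` is the vertical inclusion, so differentiating a product gives the
Leibniz rule along the vertical lift (`flatLift_mul`), and degrees are kept (`flatLift_mem`).

Pairing the curve with covectors `A` is the same as pairing `ξ(y + t v)` with `A ∘ s_t`. The curve
`(y + t v, A ∘ s_t)` of covector tuples has velocity `ε A`, and this yields the defining identity
(`fderiv_pairing`). Uniqueness holds because pairings separate multivectors (`ext_pairing`).

To pass to a manifold, the lift must not depend on the chart (`extMap_flatLift`). For a transition
map `φ` with second tangent derivative `T`, the curves `T ∘ s_t` and `s_t ∘ Dφ(y + t v)` agree to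
first order at `t = 0`, precisely because `D²φ` is symmetric. Hence the lift may be defined at each
`w` in the preferred chart there, and it is smooth since near `w₀` the one chart at `w₀` computes it
(`coords_tangentLiftAt`). -/

namespace Multivector

/-! ### The curve of linear maps `s_t` and the derivative of a tangent map. -/

section Calculus

variable {V : Type*} [NormedAddCommGroup V] [NormedSpace ℝ V]
  {W : Type*} [NormedAddCommGroup W] [NormedSpace ℝ W]

/-- The map `a ↦ (t a, a)`. -/
noncomputable def sprout (V : Type*) [NormedAddCommGroup V] [NormedSpace ℝ V] (t : ℝ) :
    V →L[ℝ] V × V :=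
  ContinuousLinearMap.inr ℝ V V + t • ContinuousLinearMap.inl ℝ V V

@[simp] theorem sprout_zero : sprout V 0 = ContinuousLinearMap.inr ℝ V V := by simp [sprout]

theorem hasDerivAt_sprout (t : ℝ) :
    HasDerivAt (sprout V) (ContinuousLinearMap.inl ℝ V V) t := by
  have h := ((hasDerivAt_id t).smul_const (ContinuousLinearMap.inl ℝ V V)).const_add
    (ContinuousLinearMap.inr ℝ V V)
  rwa [one_smul] at h

theorem hasDerivAt_line (y v : V) (t : ℝ) : HasDerivAt (fun t : ℝ => y + t • v) v t := by
  simpa using ((hasDerivAt_id t).smul_const v).const_add y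

/-- The derivative of the tangent map of `φ`. -/
theorem hasFDerivAt_tangentMap {φ : V → W} {y : V} (hφ : ContDiffAt ℝ ∞ φ y) (v : V) :
    HasFDerivAt (fun p : V × V => (φ p.1, fderiv ℝ φ p.1 p.2))
      (((fderiv ℝ φ y) ∘L ContinuousLinearMap.fst ℝ V V).prod
        (((fderiv ℝ φ y) ∘L ContinuousLinearMap.snd ℝ V V) +
          ((fderiv ℝ (fderiv ℝ φ) y) ∘L ContinuousLinearMap.fst ℝ V V).flip v)) (y, v) := by
  have h1 : HasFDerivAt φ (fderiv ℝ φ y) y := (hφ.differentiableAt (by simp)).hasFDerivAt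
  have h2 : HasFDerivAt (fderiv ℝ φ) (fderiv ℝ (fderiv ℝ φ) y) y :=
    ((hφ.fderiv_right (m := 1) (by norm_cast)).differentiableAt (by simp)).hasFDerivAt
  have h1' := HasFDerivAt.comp (y, v) (g := φ) h1
    (hasFDerivAt_fst (𝕜 := ℝ) (E := V) (F := V) (p := (y, v)))
  have h2' := (HasFDerivAt.comp (y, v) (g := fderiv ℝ φ) h2
    (hasFDerivAt_fst (𝕜 := ℝ) (E := V) (F := V) (p := (y, v)))).clm_apply
      (hasFDerivAt_snd (𝕜 := ℝ) (E := V) (F := V) (p := (y, v)))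
  exact h1'.prodMk h2'

end Calculus

/-! ### Differential calculus with values in exterior algebras. -/

section ExteriorCalculus

variable {V : Type*} [NormedAddCommGroup V] [NormedSpace ℝ V] [FiniteDimensional ℝ V]
  {W : Type*} [NormedAddCommGroup W] [NormedSpace ℝ W] [FiniteDimensional ℝ W]
  {U : Type*} [NormedAddCommGroup U] [NormedSpace ℝ U] [FiniteDimensional ℝ U]

/-- A norm on the exterior algebra of a finite-dimensional space, the maximum of the coefficients in
some basis. -/
@[reducible] noncomputable def normedExteriorAlgebra (V : Type*) [AddCommGroup V] [Module ℝ V]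
    [FiniteDimensional ℝ V] : NormedAddCommGroup (ExteriorAlgebra ℝ V) :=
  NormedAddCommGroup.induced _ _
    (Module.finBasis ℝ (ExteriorAlgebra ℝ V)).equivFun.toLinearMap
    (Module.finBasis ℝ (ExteriorAlgebra ℝ V)).equivFun.injective

attribute [local instance] normedExteriorAlgebra

/-- The norm `normedExteriorAlgebra` is homogeneous. -/
@[reducible] noncomputable def normedSpaceExteriorAlgebra (V : Type*) [AddCommGroup V] [Module ℝ V]
    [FiniteDimensional ℝ V] : NormedSpace ℝ (ExteriorAlgebra ℝ V) :=
  NormedSpace.induced _ _ _ (Module.finBasis ℝ (ExteriorAlgebra ℝ V)).equivFun.toLinearMap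

attribute [local instance] normedSpaceExteriorAlgebra

/-- The wedge product as a continuous bilinear map. -/
noncomputable def wedgeL (V : Type*) [NormedAddCommGroup V] [NormedSpace ℝ V]
    [FiniteDimensional ℝ V] :
    ExteriorAlgebra ℝ V →L[ℝ] ExteriorAlgebra ℝ V →L[ℝ] ExteriorAlgebra ℝ V :=
  (LinearMap.mul ℝ (ExteriorAlgebra ℝ V)).toContinuousBilinearMap

@[simp] theorem wedgeL_apply (μ ν : ExteriorAlgebra ℝ V) : wedgeL V μ ν = μ * ν := rfl

/-- The continuous linear map between exterior algebras induced by a continuous linear map. -/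
noncomputable def extMap (L : V →L[ℝ] W) : ExteriorAlgebra ℝ V →L[ℝ] ExteriorAlgebra ℝ W :=
  LinearMap.toContinuousLinearMap (ExteriorAlgebra.map L.toLinearMap).toLinearMap

theorem extMap_apply (L : V →L[ℝ] W) (μ : ExteriorAlgebra ℝ V) :
    extMap L μ = ExteriorAlgebra.map L.toLinearMap μ := rfl

theorem extMap_comp (L : W →L[ℝ] U) (K : V →L[ℝ] W) (μ : ExteriorAlgebra ℝ V) :
    extMap (L ∘L K) μ = extMap L (extMap K μ) := by
  exact (DFunLike.congr_fun (ExteriorAlgebra.map_comp_map K.toLinearMap L.toLinearMap) μ).symm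

/-- For a fixed multivector the value is polynomial in the linear map, as induction on the
multivector shows. By finite dimension, smoothness may be tested on one multivector at a time. -/
theorem contDiff_extMap : ContDiff ℝ ∞ (extMap : (V →L[ℝ] W) → _) := by
  rw [contDiff_clm_apply_iff]
  intro μ
  induction μ using ExteriorAlgebra.induction with
  | algebraMap c =>
    simp only [extMap_apply, AlgHom.commutes]
    exact contDiff_const
  | ι v =>
    have h : ∀ L : V →L[ℝ] W, extMap L (ExteriorAlgebra.ι ℝ v) =
        LinearMap.toContinuousLinearMap (ExteriorAlgebra.ι ℝ (M := W)) (L v) := fun L => by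
      simp [extMap_apply]
    simp only [h]
    exact (ContinuousLinearMap.contDiff _).comp (contDiff_id.clm_apply contDiff_const)
  | mul a b ha hb =>
    have h : ∀ L : V →L[ℝ] W, extMap L (a * b) = wedgeL W (extMap L a) (extMap L b) := fun L => by
      simp [extMap_apply]
    simp only [h]
    exact ((wedgeL W).contDiff.comp ha).clm_apply hb
  | add a b ha hb =>
    simp only [map_add]
    exact ha.add hb

theorem hasFDerivAt_extMap (L : V →L[ℝ] W) : HasFDerivAt extMap (fderiv ℝ extMap L) L :=
  (contDiff_extMap.differentiable (by simp) L).hasFDerivAt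

/-- The derivative of `extMap` stays abstract: later arguments compare two curves with the same
velocity, so an explicit formula is never needed. -/
theorem hasDerivAt_extMap_apply {L : ℝ → V →L[ℝ] W} {L' : V →L[ℝ] W}
    {μ : ℝ → ExteriorAlgebra ℝ V} {μ' : ExteriorAlgebra ℝ V} {t : ℝ}
    (hL : HasDerivAt L L' t) (hμ : HasDerivAt μ μ' t) :
    HasDerivAt (fun s => extMap (L s) (μ s))
      (fderiv ℝ extMap (L t) L' (μ t) + extMap (L t) μ') t :=
  ((hasFDerivAt_extMap (L t)).comp_hasDerivAt t hL).clm_apply hμ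

theorem hasDerivAt_wedge {μ ν : ℝ → ExteriorAlgebra ℝ V} {μ' ν' : ExteriorAlgebra ℝ V} {t : ℝ}
    (hμ : HasDerivAt μ μ' t) (hν : HasDerivAt ν ν' t) :
    HasDerivAt (fun s => μ s * ν s) (μ' * ν t + μ t * ν') t :=
  ((wedgeL V).hasFDerivAt.comp_hasDerivAt t hμ).clm_apply hν

/-- The derivative of a curve in a subspace lies in the subspace. -/
theorem HasDerivAt.mem_submodule {G : Type*} [NormedAddCommGroup G] [NormedSpace ℝ G]
    [FiniteDimensional ℝ G] {K : Submodule ℝ G} {f : ℝ → G} {f' : G} {t : ℝ}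
    (hf : HasDerivAt f f' t) (h : ∀ s, f s ∈ K) : f' ∈ K := by
  by_contra hn
  -- A functional that kills `K` but not `f'` would be constant along the curve and yet have nonzero
  -- derivative.
  obtain ⟨ℓ, hℓ, hK⟩ := Submodule.exists_le_ker_of_notMem hn
  have h1 := (LinearMap.toContinuousLinearMap ℓ).hasFDerivAt.comp_hasDerivAt t hf
  have h2 : (LinearMap.toContinuousLinearMap ℓ ∘ f) = fun _ => 0 := funext fun s => hK (h s)
  rw [h2] at h1
  exact hℓ ((hasDerivAt_const t (0 : ℝ)).unique h1).symm

theorem map_mem_exteriorPower {V W : Type*} [AddCommGroup V] [Module ℝ V] [AddCommGroup W]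
    [Module ℝ W] (L : V →ₗ[ℝ] W) {q : ℕ} {μ : ExteriorAlgebra ℝ V} (hμ : μ ∈ ⋀[ℝ]^q V) :
    ExteriorAlgebra.map L μ ∈ ⋀[ℝ]^q W := by
  have h : ⋀[ℝ]^q V ≤ (⋀[ℝ]^q W).comap (ExteriorAlgebra.map L).toLinearMap := by
    rw [← exteriorPower.ιMulti_span_fixedDegree, Submodule.span_le]
    rintro _ ⟨v, rfl⟩
    simp only [Submodule.comap_coe, mem_preimage, AlgHom.toLinearMap_apply,
      ExteriorAlgebra.map_apply_ιMulti]
    exact ExteriorAlgebra.ιMulti_range ℝ q (mem_range_self _)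
  exact h hμ

/-- A multivector is determined by its pairings with tuples of covectors. -/
theorem ext_pairing {μ ν : ExteriorAlgebra ℝ V}
    (h : ∀ (r : ℕ) (A : V →L[ℝ] (Fin r → ℝ)), pairing A μ = pairing A ν) : μ = ν := by
  let b := Module.finBasis ℝ V
  refine b.ExteriorAlgebra.ext_elem fun s => ?_
  let s' : Set.powersetCard (Fin (Module.finrank ℝ V)) s.card := Set.powersetCard.ofCard rfl
  -- The dual basis covectors indexed by the elements of `s` in increasing order; pairing with them
  -- extracts the coefficient of the basis multivector of `s`.
  let A : V →L[ℝ] (Fin s.card → ℝ) := LinearMap.toContinuousLinearMap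
    (LinearMap.pi fun j => b.coord (Set.powersetCard.ofFinEmbEquiv.symm s' j))
  have key : b.ExteriorAlgebra.coord s = pairing A := by
    refine b.ExteriorAlgebra.ext fun t => ?_
    rw [Module.Basis.coord_apply, Module.Basis.repr_self, ExteriorAlgebra.basis_apply_ofCard b rfl]
    simp only [pairing, LinearMap.comp_apply, AlgHom.toLinearMap_apply,
      ExteriorAlgebra.map_apply_ιMulti, topCoeff, ExteriorAlgebra.liftAlternating_apply_ιMulti]
    by_cases hc : t.card = s.card
    · let t' : Set.powersetCard (Fin (Module.finrank ℝ V)) s.card := Set.powersetCard.ofCard hc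
      -- `t.card` and `s.card` are equal only propositionally, so the degree is generalized to `n`
      -- in order to transport the alternating map from one to the other.
      have e : ∀ (n : ℕ) (h : t.card = n), (Pi.single s.card Matrix.detRowAlternating :
          ∀ i, (Fin s.card → ℝ) [⋀^Fin i]→ₗ[ℝ] ℝ) t.card
          (A ∘ b ∘ Set.powersetCard.ofFinEmbEquiv.symm (Set.powersetCard.ofCard (rfl : t.card = t.card)))
          = (Pi.single s.card Matrix.detRowAlternating :
          ∀ i, (Fin s.card → ℝ) [⋀^Fin i]→ₗ[ℝ] ℝ) n
          (A ∘ b ∘ Set.powersetCard.ofFinEmbEquiv.symm (Set.powersetCard.ofCard h)) := by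
        rintro _ rfl; rfl
      refine Eq.trans ?_ (e _ hc).symm
      rw [Pi.single_eq_same]
      have h1 : Matrix.detRowAlternating (A ∘ b ∘ Set.powersetCard.ofFinEmbEquiv.symm t') =
          exteriorPower.ιMultiDual ℝ s.card b s' (exteriorPower.ιMulti_family ℝ s.card b t') := by
        rw [exteriorPower.ιMulti_family, exteriorPower.ιMultiDual_apply_ιMulti]
        rfl
      refine Eq.trans ?_ h1.symm
      by_cases hst : s' = t'
      · rw [← hst, exteriorPower.ιMultiDual_apply_diag]
        have : t = s := (congrArg Subtype.val hst).symm
        simp [this]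
      · rw [exteriorPower.ιMultiDual_apply_nondiag _ _ _ _ _ hst]
        have : t ≠ s := fun h => hst (Subtype.ext h.symm)
        simp [this]
    · rw [Pi.single_eq_of_ne hc]
      have : t ≠ s := fun h => hc (by rw [h])
      simp [this]
  have h2 := h _ A
  rwa [← key] at h2

/-! ### The tangent lift on a vector space. -/

/-- The tangent lift at `(y, v)` of a multivector field `ξ` on a vector space. -/
noncomputable def flatLift (ξ : V → ExteriorAlgebra ℝ V) (y v : V) : ExteriorAlgebra ℝ (V × V) :=
  fderiv ℝ extMap (ContinuousLinearMap.inr ℝ V V) (ContinuousLinearMap.inl ℝ V V) (ξ y) +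
    extMap (ContinuousLinearMap.inr ℝ V V) (fderiv ℝ ξ y v)

/-- The tangent lift is the velocity of the push-forward of the multivectors along a line by the
maps `sprout`. -/
theorem hasDerivAt_sprout_line {ξ : V → ExteriorAlgebra ℝ V} {y : V} (hξ : DifferentiableAt ℝ ξ y)
    (v : V) :
    HasDerivAt (fun t : ℝ => extMap (sprout V t) (ξ (y + t • v))) (flatLift ξ y v) 0 := by
  have hξ' : HasFDerivAt ξ (fderiv ℝ ξ y) (y + (0 : ℝ) • v) := by simpa using hξ.hasFDerivAt
  simpa [flatLift] using hasDerivAt_extMap_apply (hasDerivAt_sprout (V := V) 0)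
    (hξ'.comp_hasDerivAt 0 (hasDerivAt_line y v 0))

theorem flatLift_add {ξ η : V → ExteriorAlgebra ℝ V} {y : V} (hξ : DifferentiableAt ℝ ξ y)
    (hη : DifferentiableAt ℝ η y) (v : V) :
    flatLift (fun z => ξ z + η z) y v = flatLift ξ y v + flatLift η y v := by
  simp only [flatLift, fderiv_fun_add hξ hη, map_add, add_apply]
  abel

theorem flatLift_smul {ξ : V → ExteriorAlgebra ℝ V} {y : V} (hξ : DifferentiableAt ℝ ξ y) (c : ℝ)
    (v : V) : flatLift (fun z => c • ξ z) y v = c • flatLift ξ y v := by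
  simp only [flatLift, fderiv_fun_const_smul hξ, map_smul, smul_apply, smul_add]

/-- The curve of the product is the product of the curves. Both factors are evaluated at `t = 0`,
where `sprout` is the vertical inclusion; this produces the vertical lifts. -/
theorem flatLift_mul {ξ η : V → ExteriorAlgebra ℝ V} {y : V} (hξ : DifferentiableAt ℝ ξ y)
    (hη : DifferentiableAt ℝ η y) (v : V) :
    flatLift (fun z => ξ z * η z) y v =
      flatLift ξ y v * extMap (ContinuousLinearMap.inr ℝ V V) (η y) +
        extMap (ContinuousLinearMap.inr ℝ V V) (ξ y) * flatLift η y v := by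
  have hm : DifferentiableAt ℝ (fun z => ξ z * η z) y :=
    ((wedgeL V).differentiableAt.comp y hξ).clm_apply hη
  have h1 := hasDerivAt_sprout_line hm v
  have h2 := hasDerivAt_wedge (hasDerivAt_sprout_line hξ v) (hasDerivAt_sprout_line hη v)
  simp only [extMap_apply, map_mul] at h1 h2 ⊢
  simpa using h1.unique h2

theorem flatLift_mem {ξ : V → ExteriorAlgebra ℝ V} {y : V} (hξ : DifferentiableAt ℝ ξ y) (v : V)
    {q : ℕ} (h : ∀ z, ξ z ∈ ⋀[ℝ]^q V) : flatLift ξ y v ∈ ⋀[ℝ]^q (V × V) :=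
  HasDerivAt.mem_submodule (hasDerivAt_sprout_line hξ v) fun _ => map_mem_exteriorPower _ (h _)

/-- In degree one the curve is `(t Y(y + t v), Y(y + t v))`, which can be differentiated directly.
-/
theorem flatLift_ι {Y : V → V} {y : V} (hY : DifferentiableAt ℝ Y y) (v : V) :
    flatLift (fun z => ExteriorAlgebra.ι ℝ (Y z)) y v =
      ExteriorAlgebra.ι ℝ (Y y, fderiv ℝ Y y v) := by
  have hd : DifferentiableAt ℝ (fun z => ExteriorAlgebra.ι ℝ (Y z)) y :=
    (LinearMap.toContinuousLinearMap
      (ExteriorAlgebra.ι ℝ (M := V))).differentiableAt.comp y hY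
  have hY' : HasFDerivAt Y (fderiv ℝ Y y) (y + (0 : ℝ) • v) := by simpa using hY.hasFDerivAt
  have h1 := (hasDerivAt_sprout (V := V) 0).clm_apply
    (hY'.comp_hasDerivAt 0 (hasDerivAt_line y v 0))
  have h2 := (LinearMap.toContinuousLinearMap
    (ExteriorAlgebra.ι ℝ (M := V × V))).hasFDerivAt.comp_hasDerivAt 0 h1
  have h3 := hasDerivAt_sprout_line hd v
  simp only [extMap_apply, ExteriorAlgebra.map_apply_ι] at h3
  simpa using h3.unique h2

/-- Pairing the tangent lift amounts to differentiating pairings. -/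
theorem hasDerivAt_pairing_line {ξ : V → ExteriorAlgebra ℝ V} {y : V} (hξ : DifferentiableAt ℝ ξ y)
    (v : V) {r : ℕ} (A : V × V →L[ℝ] (Fin r → ℝ)) :
    HasDerivAt (fun t : ℝ => pairing (A ∘L sprout V t) (ξ (y + t • v)))
      (pairing A (flatLift ξ y v)) 0 := by
  have h := (LinearMap.toContinuousLinearMap (pairing A)).hasFDerivAt.comp_hasDerivAt 0
    (hasDerivAt_sprout_line hξ v)
  refine h.congr_deriv rfl |>.congr_of_eventuallyEq (.of_forall fun t => ?_)
  exact congrArg (topCoeff r) (extMap_comp A (sprout V t) _)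

theorem differentiableAt_pairing {ξ : V → ExteriorAlgebra ℝ V} {y : V}
    (hξ : DifferentiableAt ℝ ξ y) {r : ℕ} (B : V →L[ℝ] (Fin r → ℝ)) :
    DifferentiableAt ℝ (fun p : V × (V →L[ℝ] (Fin r → ℝ)) => pairing p.2 (ξ p.1)) (y, B) := by
  have h : DifferentiableAt ℝ
      (fun p : V × (V →L[ℝ] (Fin r → ℝ)) => extMap p.2 (ξ p.1)) (y, B) :=
    (((contDiff_extMap.differentiable (by simp)).comp differentiable_snd) _).clm_apply
      (DifferentiableAt.comp (y, B) (g := ξ) hξ differentiableAt_fst)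
  exact (LinearMap.toContinuousLinearMap (topCoeff r)).differentiableAt.comp _ h

/-- The defining identity in coordinates: base point and direction are the coordinates of
`epsilonBase` and `epsilon`. The chain rule along `(y + t v, A ∘ s_t)` is compared with
`hasDerivAt_pairing_line`. -/
theorem fderiv_pairing {ξ : V → ExteriorAlgebra ℝ V} {y : V} (hξ : DifferentiableAt ℝ ξ y) (v : V)
    {r : ℕ} (A : V × V →L[ℝ] (Fin r → ℝ)) :
    fderiv ℝ (fun q : V × (V →L[ℝ] (Fin r → ℝ)) => pairing q.2 (ξ q.1))
      (y, A ∘L ContinuousLinearMap.inr ℝ V V) (v, A ∘L ContinuousLinearMap.inl ℝ V V) =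
    pairing A (flatLift ξ y v) := by
  have hc : HasDerivAt (fun t : ℝ => (y + t • v, A ∘L sprout V t))
      (v, A ∘L ContinuousLinearMap.inl ℝ V V) 0 :=
    (hasDerivAt_line y v 0).prodMk
      (by simpa using (hasDerivAt_const (0 : ℝ) A).clm_comp (hasDerivAt_sprout (V := V) 0))
  have hG := (differentiableAt_pairing hξ (A ∘L ContinuousLinearMap.inr ℝ V V)).hasFDerivAt
  have h0 : ((y + (0 : ℝ) • v, A ∘L sprout V 0) : V × (V →L[ℝ] (Fin r → ℝ))) =
      (y, A ∘L ContinuousLinearMap.inr ℝ V V) := by simp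
  rw [← h0] at hG ⊢
  have h := hG.comp_hasDerivAt 0 hc
  exact h.unique (hasDerivAt_pairing_line hξ v A)

/-- The tangent lift commutes with changes of coordinates. -/
theorem extMap_flatLift {φ : V → W} {y : V} (hφ : ContDiffAt ℝ ∞ φ y)
    {ξ : V → ExteriorAlgebra ℝ V} {η : W → ExteriorAlgebra ℝ W} (hξ : DifferentiableAt ℝ ξ y)
    (hη : DifferentiableAt ℝ η (φ y))
    (h : ∀ᶠ z in nhds y, η (φ z) = extMap (fderiv ℝ φ z) (ξ z)) (v : V) :
    extMap (fderiv ℝ (fun p : V × V => (φ p.1, fderiv ℝ φ p.1 p.2)) (y, v)) (flatLift ξ y v) =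
      flatLift η (φ y) (fderiv ℝ φ y v) := by
  set T := fderiv ℝ (fun p : V × V => (φ p.1, fderiv ℝ φ p.1 p.2)) (y, v) with hT
  rw [(hasFDerivAt_tangentMap hφ v).fderiv] at hT
  have hline0 : y + (0 : ℝ) • v = y := by simp
  have hφ1 : HasFDerivAt φ (fderiv ℝ φ y) (y + (0 : ℝ) • v) := by
    rw [hline0]; exact (hφ.differentiableAt (by simp)).hasFDerivAt
  have hφ2 : HasFDerivAt (fderiv ℝ φ) (fderiv ℝ (fderiv ℝ φ) y) (y + (0 : ℝ) • v) := by
    rw [hline0]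
    exact ((hφ.fderiv_right (m := 1) (by norm_cast)).differentiableAt (by simp)).hasFDerivAt
  have hξ' : HasFDerivAt ξ (fderiv ℝ ξ y) (y + (0 : ℝ) • v) := by simpa using hξ.hasFDerivAt
  have hη' : HasFDerivAt η (fderiv ℝ η (φ y)) (φ (y + (0 : ℝ) • v)) := by
    simpa using hη.hasFDerivAt
  have hl := hasDerivAt_line y v 0
  have hsymm : IsSymmSndFDerivAt ℝ φ y := hφ.isSymmSndFDerivAt (by
    rw [minSmoothness_of_isRCLikeNormedField]; norm_cast)
  have c1 : HasDerivAt (fun t : ℝ => T ∘L sprout V t) (T ∘L ContinuousLinearMap.inl ℝ V V) 0 := by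
    simpa using (hasDerivAt_const (0 : ℝ) T).clm_comp (hasDerivAt_sprout (V := V) 0)
  have d1 := hasDerivAt_extMap_apply c1 (hξ'.comp_hasDerivAt 0 hl)
  have c2 := (hasDerivAt_sprout (V := W) 0).clm_comp (hφ2.comp_hasDerivAt 0 hl)
  have d2 := hasDerivAt_extMap_apply c2 (hξ'.comp_hasDerivAt 0 hl)
  -- The lift of `η` is computed along `φ (y + t v)` instead of a straight line; only the point and
  -- the velocity at `t = 0` matter.
  have d3 := hasDerivAt_extMap_apply (hasDerivAt_sprout (V := W) 0)
    (hη'.comp_hasDerivAt 0 (hφ1.comp_hasDerivAt 0 hl))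
  have e1 : T ∘L ContinuousLinearMap.inr ℝ V V =
      ContinuousLinearMap.inr ℝ W W ∘L fderiv ℝ φ y := by
    ext a <;> simp [hT]
  -- The velocities of `T ∘ s_t` and of `s_t ∘ Dφ(y + t v)` coincide. The vertical components are
  -- `D²φ(a) v` and `D²φ(v) a`, so symmetry of the second derivative enters here.
  have e2 : T ∘L ContinuousLinearMap.inl ℝ V V =
      ContinuousLinearMap.inl ℝ W W ∘L fderiv ℝ φ y +
        ContinuousLinearMap.inr ℝ W W ∘L fderiv ℝ (fderiv ℝ φ) y v := by
    ext a
    · simp [hT]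
    · simp [hT, hsymm.eq a v]
  have hl' : Filter.Tendsto (fun t : ℝ => y + t • v) (nhds 0) (nhds y) := by
    simpa using hl.continuousAt.tendsto
  have d4 := d3.congr_of_eventuallyEq
    (f₁ := fun t : ℝ => extMap (sprout W t ∘L fderiv ℝ φ (y + t • v)) (ξ (y + t • v))) (by
      filter_upwards [hl'.eventually h] with t ht
      simp [extMap_comp, ht])
  have d5 := d2.unique d4
  have d6 := d1.unique ((extMap T).hasFDerivAt.comp_hasDerivAt 0 (hasDerivAt_sprout_line hξ v)
    |>.congr_of_eventuallyEq (.of_forall fun t => extMap_comp T (sprout V t) _))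
  rw [← d6]
  simp only [sprout_zero, Function.comp_apply, hline0, e1, e2] at d5 ⊢
  exact d5

end ExteriorCalculus

/-! ### Coordinate changes on the manifold and on its tangent bundle. -/

section TangentLift

variable {E : Type*} [NormedAddCommGroup E] [NormedSpace ℝ E]
  {M : Type*} [TopologicalSpace M] [ChartedSpace E M]

variable (E) in
/-- The transition map from the preferred chart at `x` to the preferred chart at `x₀`. -/
noncomputable def transition (x x₀ : M) : E → E :=
  extChartAt 𝓘(ℝ, E) x₀ ∘ (extChartAt 𝓘(ℝ, E) x).symm

theorem transition_extChartAt {x x₀ z : M} (hx : z ∈ (chartAt E x).source) :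
    transition E x x₀ (extChartAt 𝓘(ℝ, E) x z) = extChartAt 𝓘(ℝ, E) x₀ z := by
  rw [transition, Function.comp_apply, (extChartAt 𝓘(ℝ, E) x).left_inv (by simpa using hx)]

/-- The tangent space at a point is the model space, read in the preferred chart there. This allows
vectors at `x` to be identified with their coordinates. -/
theorem continuousLinearMapAt_self {H F N : Type*} [NormedAddCommGroup F] [NormedSpace ℝ F]
    [TopologicalSpace H] (I : ModelWithCorners ℝ F H) [TopologicalSpace N] [ChartedSpace H N]
    [IsManifold I 1 N] (x : N) (u : TangentSpace I x) :
    (trivializationAt F (TangentSpace I : N → Type _) x).continuousLinearMapAt ℝ x u = u := by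
  rw [TangentBundle.continuousLinearMapAt_trivializationAt_eq_core (mem_chart_source H x)]
  exact tangentCoordChange_self (I := I) (mem_extChartAt_source x)

variable [IsManifold 𝓘(ℝ, E) ∞ M]

theorem contDiffAt_transition {x x₀ z : M} (hx : z ∈ (chartAt E x).source)
    (hx₀ : z ∈ (chartAt E x₀).source) :
    ContDiffAt ℝ ∞ (transition E x x₀) (extChartAt 𝓘(ℝ, E) x z) := by
  have h := contDiffWithinAt_ext_coord_change (I := 𝓘(ℝ, E)) (n := ∞) x₀ x
    (y := extChartAt 𝓘(ℝ, E) x z) (by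
      rw [PartialEquiv.trans_source, PartialEquiv.symm_source]
      refine ⟨(extChartAt 𝓘(ℝ, E) x).map_source (by simpa using hx), ?_⟩
      rw [mem_preimage, (extChartAt 𝓘(ℝ, E) x).left_inv (by simpa using hx)]
      simpa using hx₀)
  rw [modelWithCornersSelf_coe, range_id, contDiffWithinAt_univ] at h
  exact h

theorem tangentCoordChange_eq_fderiv (x x₀ z : M) :
    tangentCoordChange 𝓘(ℝ, E) x x₀ z =
      fderiv ℝ (transition E x x₀) (extChartAt 𝓘(ℝ, E) x z) := by
  rw [tangentCoordChange_def, modelWithCornersSelf_coe, range_id, fderivWithin_univ]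
  rfl

/-- Change of the coordinates of a tangent vector. -/
theorem continuousLinearMapAt_eq_fderiv_transition {x x₀ z : M} (hx : z ∈ (chartAt E x).source)
    (hx₀ : z ∈ (chartAt E x₀).source) (u : TangentSpace 𝓘(ℝ, E) z) :
    (trivializationAt E (TangentSpace 𝓘(ℝ, E) : M → Type _) x₀).continuousLinearMapAt ℝ z u =
      fderiv ℝ (transition E x x₀) (extChartAt 𝓘(ℝ, E) x z)
        ((trivializationAt E (TangentSpace 𝓘(ℝ, E) : M → Type _) x).continuousLinearMapAt
          ℝ z u) := by
  rw [← tangentCoordChange_eq_fderiv,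
    TangentBundle.continuousLinearMapAt_trivializationAt_eq_core hx₀,
    TangentBundle.continuousLinearMapAt_trivializationAt_eq_core hx]
  exact (tangentCoordChange_comp (I := 𝓘(ℝ, E)) (w := z) (x := x) (y := x₀) (z := z)
    (by simp [hx, hx₀])).symm

theorem extChartAt_tangentBundle (w₀ w : TangentBundle 𝓘(ℝ, E) M)
    (hw : w.1 ∈ (chartAt E w₀.1).source) :
    extChartAt 𝓘(ℝ, E).tangent w₀ w = (extChartAt 𝓘(ℝ, E) w₀.1 w.1,
      (trivializationAt E (TangentSpace 𝓘(ℝ, E) : M → Type _) w₀.1).continuousLinearMapAt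
        ℝ w.1 w.2) := by
  have hb : w.1 ∈ (trivializationAt E (TangentSpace 𝓘(ℝ, E) : M → Type _) w₀.1).baseSet := hw
  refine Prod.ext ?_ ?_
  · simp only [FiberBundle.extChartAt]; rfl
  · simp only [FiberBundle.extChartAt]
    exact (congrFun (Trivialization.coe_linearMapAt_of_mem (R := ℝ) _ hb) w.2).symm

theorem extChartAt_tangentBundle_self (w : TangentBundle 𝓘(ℝ, E) M) :
    extChartAt 𝓘(ℝ, E).tangent w w = (extChartAt 𝓘(ℝ, E) w.1 w.1, (w.2 : E)) := by
  rw [extChartAt_tangentBundle w w (mem_chart_source E w.1)]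
  exact Prod.ext rfl (continuousLinearMapAt_self 𝓘(ℝ, E) w.1 w.2)

/-- The transition maps of `TM` are the tangent maps of those of `M`. -/
theorem transition_tangentBundle (w₀ w : TangentBundle 𝓘(ℝ, E) M)
    (hw : w.1 ∈ (chartAt E w₀.1).source) :
    extChartAt 𝓘(ℝ, E).tangent w₀ ∘ (extChartAt 𝓘(ℝ, E).tangent w).symm
      =ᶠ[nhds (extChartAt 𝓘(ℝ, E).tangent w w)]
    fun p : E × E => (transition E w.1 w₀.1 p.1, fderiv ℝ (transition E w.1 w₀.1) p.1 p.2) := by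
  have h1 : ∀ᶠ p in nhds (extChartAt 𝓘(ℝ, E).tangent w w),
      p ∈ (extChartAt 𝓘(ℝ, E).tangent w).target :=
    extChartAt_target_mem_nhds w
  have h2 : ∀ᶠ p in nhds (extChartAt 𝓘(ℝ, E).tangent w w),
      ((extChartAt 𝓘(ℝ, E).tangent w).symm p).1 ∈ (chartAt E w₀.1).source := by
    have hc := (FiberBundle.continuous_proj E (TangentSpace 𝓘(ℝ, E) : M → Type _)).continuousAt.comp
      (continuousAt_extChartAt_symm (I := 𝓘(ℝ, E).tangent) w)
    refine hc.eventually ((chartAt E w₀.1).open_source.mem_nhds ?_)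
    rwa [Function.comp_apply, extChartAt_to_inv]
  refine (h1.and h2).mono fun (p : E × E) hp => ?_
  obtain ⟨z, hz⟩ : ∃ z, z = (extChartAt 𝓘(ℝ, E).tangent w).symm p := ⟨_, rfl⟩
  have hz2 : z.1 ∈ (chartAt E w₀.1).source := hz ▸ hp.2
  have hz1 : z.1 ∈ (chartAt E w.1).source := by
    have h := (extChartAt 𝓘(ℝ, E).tangent w).map_target hp.1
    rw [← hz] at h
    simpa using h
  have hpz : p = (extChartAt 𝓘(ℝ, E) w.1 z.1,
      (trivializationAt E (TangentSpace 𝓘(ℝ, E) : M → Type _) w.1).continuousLinearMapAt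
        ℝ z.1 z.2) := by
    rw [← extChartAt_tangentBundle w z hz1, hz]
    exact ((extChartAt 𝓘(ℝ, E).tangent w).right_inv hp.1).symm
  have hl : (extChartAt 𝓘(ℝ, E).tangent w₀ ∘ (extChartAt 𝓘(ℝ, E).tangent w).symm) p =
      extChartAt 𝓘(ℝ, E).tangent w₀ z := by rw [hz]; rfl
  refine hl.trans ((extChartAt_tangentBundle w₀ z hz2).trans ?_)
  rw [hpz]
  exact Prod.ext (transition_extChartAt hz1).symm
    (continuousLinearMapAt_eq_fderiv_transition hz1 hz2 z.2)

/-- The coordinates of a tangent vector of `TM` in the preferred chart at `w₀` are obtained by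
differentiating the transition map. -/
theorem continuousLinearMapAt_tangentBundle (w₀ w : TangentBundle 𝓘(ℝ, E) M)
    (hw : w.1 ∈ (chartAt E w₀.1).source) :
    (trivializationAt (E × E) (TangentSpace 𝓘(ℝ, E).tangent : TangentBundle 𝓘(ℝ, E) M → Type _)
      w₀).continuousLinearMapAt ℝ w =
    fderiv ℝ (fun p : E × E =>
      (transition E w.1 w₀.1 p.1, fderiv ℝ (transition E w.1 w₀.1) p.1 p.2))
      (extChartAt 𝓘(ℝ, E) w.1 w.1, (w.2 : E)) := by
  have hw' : w ∈ (chartAt (ModelProd E E) w₀).source := by simpa using hw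
  have hr : range (𝓘(ℝ, E).tangent : ModelProd E E → E × E) = univ :=
    𝓘(ℝ, E).tangent.range_eq_univ
  refine (TangentBundle.continuousLinearMapAt_trivializationAt_eq_core hw').trans ?_
  refine (tangentBundleCore_coordChange_achart w w₀ w).trans ?_
  rw [hr, fderivWithin_univ, (transition_tangentBundle w₀ w hw).fderiv_eq,
    extChartAt_tangentBundle_self]
  rfl

end TangentLift

/-! ### Multivector fields and covector tuples in charts. -/

section TangentLift

theorem eventually_symm_mem_source {E M : Type*} [NormedAddCommGroup E] [NormedSpace ℝ E]
    [TopologicalSpace M] [ChartedSpace E M] {x x₀ : M} (hx : x ∈ (chartAt E x₀).source) (z : M)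
    (hz : x ∈ (chartAt E z).source) :
    ∀ᶠ y in nhds (extChartAt 𝓘(ℝ, E) z x), y ∈ (extChartAt 𝓘(ℝ, E) z).target ∧
      (extChartAt 𝓘(ℝ, E) z).symm y ∈ (chartAt E x₀).source := by
  have hz' : x ∈ (extChartAt 𝓘(ℝ, E) z).source := by simpa using hz
  have h1 : ∀ᶠ y in nhds (extChartAt 𝓘(ℝ, E) z x), y ∈ (extChartAt 𝓘(ℝ, E) z).target :=
    extChartAt_target_mem_nhds' ((extChartAt 𝓘(ℝ, E) z).map_source hz')
  refine h1.and ((continuousAt_extChartAt_symm' hz').eventually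
    ((chartAt E x₀).open_source.mem_nhds ?_))
  rwa [(extChartAt 𝓘(ℝ, E) z).left_inv hz']

attribute [local instance] normedExteriorAlgebra normedSpaceExteriorAlgebra

variable {E : Type*} [NormedAddCommGroup E] [NormedSpace ℝ E]
  {M : Type*} [TopologicalSpace M] [ChartedSpace E M] [IsManifold 𝓘(ℝ, E) ∞ M]

theorem coords_self (x : M) (μ : ExteriorAlgebra ℝ (TangentSpace 𝓘(ℝ, E) x)) :
    coords 𝓘(ℝ, E) x x μ = (μ : ExteriorAlgebra ℝ E) := by
  have h : ((trivializationAt E (TangentSpace 𝓘(ℝ, E) : M → Type _) x).continuousLinearMapAt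
      ℝ x).toLinearMap = (LinearMap.id : E →ₗ[ℝ] E) :=
    LinearMap.ext fun u => continuousLinearMapAt_self 𝓘(ℝ, E) x u
  exact (congrArg (fun L : E →ₗ[ℝ] E => ExteriorAlgebra.map L (μ : ExteriorAlgebra ℝ E)) h).trans
    (DFunLike.congr_fun ExteriorAlgebra.map_id _)

theorem extChartAt_covectorTuples {r : ℕ} (p₀ p : CovectorTuples 𝓘(ℝ, E) M r) :
    extChartAt (𝓘(ℝ, E).prod 𝓘(ℝ, E →L[ℝ] (Fin r → ℝ))) p₀ p =
      (extChartAt 𝓘(ℝ, E) p₀.1 p.1, (p.2 ∘L (trivializationAt E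
        (TangentSpace 𝓘(ℝ, E) : M → Type _) p₀.1).symmL ℝ p.1 : E →L[ℝ] (Fin r → ℝ))) := by
  refine Prod.ext ?_ ?_
  · simp only [FiberBundle.extChartAt]; rfl
  · simp only [FiberBundle.extChartAt]
    refine ContinuousLinearMap.ext fun u => ?_
    exact DFunLike.congr_fun
      (Bundle.Trivial.continuousLinearMapAt_trivialization ℝ M (Fin r → ℝ) p.1) _

theorem extChartAt_epsilonBase {r : ℕ} {w : TangentBundle 𝓘(ℝ, E) M}
    (A : TangentSpace 𝓘(ℝ, E).tangent w →L[ℝ] (Fin r → ℝ)) :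
    extChartAt (𝓘(ℝ, E).prod 𝓘(ℝ, E →L[ℝ] (Fin r → ℝ))) (epsilonBase 𝓘(ℝ, E) A)
      (epsilonBase 𝓘(ℝ, E) A) = (extChartAt 𝓘(ℝ, E) w.1 w.1,
        (A : E × E →L[ℝ] (Fin r → ℝ)) ∘L ContinuousLinearMap.inr ℝ E E) := by
  rw [extChartAt_covectorTuples]
  refine Prod.ext rfl (ContinuousLinearMap.ext fun u => ?_)
  let e := trivializationAt E (TangentSpace 𝓘(ℝ, E) : M → Type _) w.1
  have h : e.symmL ℝ w.1 u = (u : E) := by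
    have h1 := e.symmL_continuousLinearMapAt (R := ℝ) (mem_chart_source E w.1)
      (u : TangentSpace 𝓘(ℝ, E) w.1)
    exact (congrArg (e.symmL ℝ w.1)
      (continuousLinearMapAt_self 𝓘(ℝ, E) w.1 (u : TangentSpace 𝓘(ℝ, E) w.1))).symm.trans h1
  exact congrArg (fun u : E => (A : E × E →L[ℝ] (Fin r → ℝ)) (0, u)) h

variable [FiniteDimensional ℝ E]

/-- A multivector field in the coordinates of the preferred chart at `x₀`. -/
noncomputable def localRep (X : MultivectorField 𝓘(ℝ, E) M) (x₀ : M) (y : E) :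
    ExteriorAlgebra ℝ E :=
  coords 𝓘(ℝ, E) x₀ ((extChartAt 𝓘(ℝ, E) x₀).symm y) (X.1 ((extChartAt 𝓘(ℝ, E) x₀).symm y))

theorem localRep_extChartAt (X : MultivectorField 𝓘(ℝ, E) M) {x₀ x : M}
    (hx : x ∈ (chartAt E x₀).source) :
    localRep X x₀ (extChartAt 𝓘(ℝ, E) x₀ x) = coords 𝓘(ℝ, E) x₀ x (X.1 x) := by
  have h := (extChartAt 𝓘(ℝ, E) x₀).left_inv (x := x) (by simpa using hx)
  exact congrArg (fun z => coords 𝓘(ℝ, E) x₀ z (X.1 z)) h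

theorem localRep_self (X : MultivectorField 𝓘(ℝ, E) M) (x : M) :
    localRep X x (extChartAt 𝓘(ℝ, E) x x) = (X.1 x : ExteriorAlgebra ℝ E) := by
  rw [localRep_extChartAt X (mem_chart_source E x), coords_self]

theorem coords_transition {x x₀ z : M} (hx : z ∈ (chartAt E x).source)
    (hx₀ : z ∈ (chartAt E x₀).source) (μ : ExteriorAlgebra ℝ (TangentSpace 𝓘(ℝ, E) z)) :
    coords 𝓘(ℝ, E) x₀ z μ = extMap (fderiv ℝ (transition E x x₀) (extChartAt 𝓘(ℝ, E) x z))
      (coords 𝓘(ℝ, E) x z μ) := by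
  have h : ((trivializationAt E (TangentSpace 𝓘(ℝ, E) : M → Type _) x₀).continuousLinearMapAt
      ℝ z).toLinearMap =
      (fderiv ℝ (transition E x x₀) (extChartAt 𝓘(ℝ, E) x z)).toLinearMap ∘ₗ
      ((trivializationAt E (TangentSpace 𝓘(ℝ, E) : M → Type _) x).continuousLinearMapAt
      ℝ z).toLinearMap :=
    LinearMap.ext fun u => continuousLinearMapAt_eq_fderiv_transition hx hx₀ u
  rw [coords, h, ← ExteriorAlgebra.map_comp_map]
  rfl

/-- Change of coordinates of a multivector field. -/
theorem localRep_transition (X : MultivectorField 𝓘(ℝ, E) M) {x x₀ z : M}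
    (hx : z ∈ (chartAt E x).source) (hx₀ : z ∈ (chartAt E x₀).source) :
    ∀ᶠ y in nhds (extChartAt 𝓘(ℝ, E) x z), localRep X x₀ (transition E x x₀ y) =
      extMap (fderiv ℝ (transition E x x₀) y) (localRep X x y) := by
  filter_upwards [eventually_symm_mem_source hx₀ x hx] with y hy
  have hs : (extChartAt 𝓘(ℝ, E) x).symm y ∈ (chartAt E x).source := by
    simpa using (extChartAt 𝓘(ℝ, E) x).map_target hy.1
  have h := coords_transition hs hy.2 (X.1 ((extChartAt 𝓘(ℝ, E) x).symm y))
  rw [(extChartAt 𝓘(ℝ, E) x).right_inv hy.1, ← localRep_extChartAt X hy.2] at h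
  exact h

/-- Smoothness of `X` is stated for scalar coefficients; a basis of the exterior algebra reassembles
them. -/
theorem contDiffAt_localRep_self (X : MultivectorField 𝓘(ℝ, E) M) (x : M) :
    ContDiffAt ℝ ∞ (localRep X x) (extChartAt 𝓘(ℝ, E) x x) := by
  let b := Module.finBasis ℝ (ExteriorAlgebra ℝ E)
  have h : ∀ y, localRep X x y = ∑ i, b.coord i (localRep X x y) • b i := fun y =>
    (b.sum_repr _).symm
  rw [funext h]
  refine ContDiffAt.sum fun i _ => ContDiffAt.fun_smul ?_ contDiffAt_const
  have h1 := (contMDiffAt_iff.1 (X.2 x (b.coord i))).2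
  rw [modelWithCornersSelf_coe, range_id, contDiffWithinAt_univ] at h1
  exact h1

/-- `IsSmooth` controls the chart at `x₀` only at `x₀` itself. At another point `x` of its domain,
smoothness comes from the chart at `x` through the transition map. -/
theorem contDiffAt_localRep (X : MultivectorField 𝓘(ℝ, E) M) {x x₀ : M}
    (hx : x ∈ (chartAt E x₀).source) :
    ContDiffAt ℝ ∞ (localRep X x₀) (extChartAt 𝓘(ℝ, E) x₀ x) := by
  have hxx := mem_chart_source E x
  have hback : transition E x₀ x (extChartAt 𝓘(ℝ, E) x₀ x) = extChartAt 𝓘(ℝ, E) x x :=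
    transition_extChartAt hx
  have hψ := contDiffAt_transition (E := E) hx hxx
  have hφ := contDiffAt_transition (E := E) hxx hx
  have h1 : ContDiffAt ℝ ∞ (fun y => extMap (fderiv ℝ (transition E x x₀) y) (localRep X x y))
      (transition E x₀ x (extChartAt 𝓘(ℝ, E) x₀ x)) := by
    rw [hback]
    exact (contDiff_extMap.contDiffAt.comp _ (hφ.fderiv_right (by norm_cast))).clm_apply
      (contDiffAt_localRep_self X x)
  refine (h1.comp _ hψ).congr_of_eventuallyEq ?_
  have h2 := localRep_transition X hxx hx
  rw [← hback] at h2
  filter_upwards [hψ.continuousAt.eventually h2, eventually_symm_mem_source hxx x₀ hx] with y hy hy2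
  have hs : (extChartAt 𝓘(ℝ, E) x₀).symm y ∈ (chartAt E x₀).source := by
    simpa using (extChartAt 𝓘(ℝ, E) x₀).map_target hy2.1
  have h3 : transition E x x₀ (transition E x₀ x y) = y := by
    have := transition_extChartAt (x₀ := x₀) hy2.2
    rwa [(extChartAt 𝓘(ℝ, E) x₀).right_inv hy2.1] at this
  rw [h3] at hy
  exact hy

theorem differentiableAt_localRep (X : MultivectorField 𝓘(ℝ, E) M) (x : M) :
    DifferentiableAt ℝ (localRep X x) (extChartAt 𝓘(ℝ, E) x x) :=
  (contDiffAt_localRep_self X x).differentiableAt (by simp)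

/-! ### The tangent lift on a manifold. -/

/-- The value at `w` of the tangent lift of a multivector field. -/
noncomputable def tangentLiftAt (X : MultivectorField 𝓘(ℝ, E) M) (w : TangentBundle 𝓘(ℝ, E) M) :
    ExteriorAlgebra ℝ (TangentSpace 𝓘(ℝ, E).tangent w) :=
  (flatLift (localRep X w.1) (extChartAt 𝓘(ℝ, E) w.1 w.1) (w.2 : E) : ExteriorAlgebra ℝ (E × E))

theorem tangentLiftAt_eq (X : MultivectorField 𝓘(ℝ, E) M) (w : TangentBundle 𝓘(ℝ, E) M) :
    (tangentLiftAt X w : ExteriorAlgebra ℝ (E × E)) =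
      flatLift (localRep X w.1) (extChartAt 𝓘(ℝ, E) w.1 w.1) (w.2 : E) := rfl

/-- The tangent lift in the coordinates of an arbitrary preferred chart. -/
theorem coords_tangentLiftAt (X : MultivectorField 𝓘(ℝ, E) M) {w₀ w : TangentBundle 𝓘(ℝ, E) M}
    (hw : w.1 ∈ (chartAt E w₀.1).source) :
    coords 𝓘(ℝ, E).tangent w₀ w (tangentLiftAt X w) =
      flatLift (localRep X w₀.1) (extChartAt 𝓘(ℝ, E).tangent w₀ w).1
        (extChartAt 𝓘(ℝ, E).tangent w₀ w).2 := by
  have hww := mem_chart_source E w.1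
  have hφ := transition_extChartAt (x₀ := w₀.1) hww
  have h := extMap_flatLift (contDiffAt_transition hww hw) (differentiableAt_localRep X w.1)
    (η := localRep X w₀.1)
    (by rw [hφ]; exact (contDiffAt_localRep X hw).differentiableAt (by simp))
    (localRep_transition X hww hw) (w.2 : E)
  rw [← continuousLinearMapAt_tangentBundle w₀ w hw, hφ] at h
  refine Eq.trans h ?_
  rw [extChartAt_tangentBundle w₀ w hw]
  congr 1
  rw [continuousLinearMapAt_eq_fderiv_transition hww hw, continuousLinearMapAt_self 𝓘(ℝ, E)]

theorem contDiffAt_flatLift {ξ : E → ExteriorAlgebra ℝ E} {p : E × E}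
    (hξ : ContDiffAt ℝ ∞ ξ p.1) : ContDiffAt ℝ ∞ (fun q : E × E => flatLift ξ q.1 q.2) p := by
  have h1 : ContDiffAt ℝ ∞ (fun q : E × E => ξ q.1) p := hξ.comp p contDiffAt_fst
  have h2 : ContDiffAt ℝ ∞ (fun q : E × E => fderiv ℝ ξ q.1 q.2) p :=
    ((hξ.fderiv_right (m := ∞) (by norm_cast)).comp p contDiffAt_fst).clm_apply contDiffAt_snd
  exact (contDiffAt_const.clm_apply h1).add (contDiffAt_const.clm_apply h2)

/-- The definition changes chart with every `w`. Chart independence replaces all these charts by the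
single one at `w₀`, where the formula is visibly smooth. -/
theorem isSmooth_tangentLiftAt (X : MultivectorField 𝓘(ℝ, E) M) :
    IsSmooth 𝓘(ℝ, E).tangent (tangentLiftAt X) := by
  intro w₀ ℓ
  have h1 : ContDiffAt ℝ ∞ (fun q : E × E => ℓ (flatLift (localRep X w₀.1) q.1 q.2))
      (extChartAt 𝓘(ℝ, E).tangent w₀ w₀) := by
    refine (LinearMap.toContinuousLinearMap ℓ).contDiff.contDiffAt.comp _ (contDiffAt_flatLift ?_)
    rw [extChartAt_tangentBundle_self]
    exact contDiffAt_localRep_self X w₀.1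
  have h2 := h1.contMDiffAt.comp w₀ (contMDiffAt_extChartAt (I := 𝓘(ℝ, E).tangent) (n := ∞))
  refine h2.congr_of_eventuallyEq ?_
  have hx : ∀ᶠ w : TangentBundle 𝓘(ℝ, E) M in nhds w₀, w.1 ∈ (chartAt E w₀.1).source :=
    (FiberBundle.continuous_proj E
      (TangentSpace 𝓘(ℝ, E) : M → Type _)).continuousAt.eventually
      ((chartAt E w₀.1).open_source.mem_nhds (mem_chart_source E w₀.1))
  filter_upwards [hx] with w hw
  exact congrArg ℓ (coords_tangentLiftAt X hw)

/-- The tangent lift of multivector fields. -/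
noncomputable def tangentLift : MultivectorField 𝓘(ℝ, E) M →ₗ[ℝ]
    MultivectorField 𝓘(ℝ, E).tangent (TangentBundle 𝓘(ℝ, E) M) where
  toFun X := ⟨tangentLiftAt X, isSmooth_tangentLiftAt X⟩
  map_add' X Z := by
    ext w
    have h : localRep (X + Z) w.1 = fun y => localRep X w.1 y + localRep Z w.1 y :=
      funext fun y => map_add _ _ _
    refine (tangentLiftAt_eq (X + Z) w).trans ?_
    rw [h]
    exact flatLift_add (differentiableAt_localRep X w.1) (differentiableAt_localRep Z w.1) _
  map_smul' c X := by
    ext w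
    have h : localRep (c • X) w.1 = fun y => c • localRep X w.1 y :=
      funext fun y => map_smul (coords 𝓘(ℝ, E) w.1 _) c _
    refine (tangentLiftAt_eq (c • X) w).trans ?_
    rw [h]
    exact flatLift_smul (differentiableAt_localRep X w.1) c _

theorem verticalLift_mem (q : ℕ) {X : MultivectorField 𝓘(ℝ, E) M}
    (hX : X ∈ multivectorDegree 𝓘(ℝ, E) M q) :
    verticalLift 𝓘(ℝ, E) X ∈
      multivectorDegree 𝓘(ℝ, E).tangent (TangentBundle 𝓘(ℝ, E) M) q :=
  fun w => map_mem_exteriorPower (vert 𝓘(ℝ, E) w).toLinearMap (hX w.1)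

theorem tangentLift_mem (q : ℕ) {X : MultivectorField 𝓘(ℝ, E) M}
    (hX : X ∈ multivectorDegree 𝓘(ℝ, E) M q) :
    tangentLift X ∈ multivectorDegree 𝓘(ℝ, E).tangent (TangentBundle 𝓘(ℝ, E) M) q :=
  fun w => flatLift_mem (differentiableAt_localRep X w.1) _
    fun _ => map_mem_exteriorPower _ (hX _)

theorem tangentLift_mul (X Z : MultivectorField 𝓘(ℝ, E) M) :
    tangentLift (X * Z) = tangentLift X * verticalLift 𝓘(ℝ, E) Z +
      verticalLift 𝓘(ℝ, E) X * tangentLift Z := by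
  ext w
  have h : localRep (X * Z) w.1 = fun y => localRep X w.1 y * localRep Z w.1 y :=
    funext fun y => map_mul _ _ _
  have h1 := flatLift_mul (differentiableAt_localRep X w.1) (differentiableAt_localRep Z w.1)
    (w.2 : E)
  -- In the chart at the base point, the coordinates of `X` and `Z` are their values, and `vert` is
  -- the second inclusion by definition.
  rw [localRep_self, localRep_self, ← h] at h1
  exact h1

theorem isDerivationAlong_tangentLift :
    IsDerivationAlong (multivectorDegree 𝓘(ℝ, E) M)
      (multivectorDegree 𝓘(ℝ, E).tangent (TangentBundle 𝓘(ℝ, E) M))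
      (verticalLift 𝓘(ℝ, E)) 0 tangentLift where
  hom_mem q _ hX := verticalLift_mem q hX
  mem q _ hX := tangentLift_mem q hX
  -- The lift has degree `0`, so the sign is `(-1) ^ (q * 0) = 1`.
  leibniz q X _ Z := by simpa using tangentLift_mul X Z

theorem tangentLift_ofVectorField
    (Y : Cₛ^∞⟮𝓘(ℝ, E); E, (TangentSpace 𝓘(ℝ, E) : M → Type _)⟯)
    (w : TangentBundle 𝓘(ℝ, E) M) :
    (tangentLift (ofVectorField 𝓘(ℝ, E) Y)).1 w =
      ExteriorAlgebra.ι ℝ (completeLift 𝓘(ℝ, E) Y w) := by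
  let e := trivializationAt E (TangentSpace 𝓘(ℝ, E) : M → Type _) w.1
  let ψ := extChartAt 𝓘(ℝ, E) w.1
  let η : E → E := fun y => e.continuousLinearMapAt ℝ (ψ.symm y) (Y (ψ.symm y))
  have hrep : localRep (ofVectorField 𝓘(ℝ, E) Y) w.1 = fun y => ExteriorAlgebra.ι ℝ (η y) :=
    funext fun y => ExteriorAlgebra.map_apply_ι _ _
  have hsm := (contMDiffAt_section (n := ∞) (F := E) (IB := 𝓘(ℝ, E))
    (E := (TangentSpace 𝓘(ℝ, E) : M → Type _)) (s := fun x => Y x) w.1).1 (Y.contMDiff w.1)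
  let D : E →L[ℝ] E := mfderiv 𝓘(ℝ, E) 𝓘(ℝ, E) (fun x => (e ⟨x, Y x⟩).2) w.1
  have hd : HasFDerivWithinAt (writtenInExtChartAt 𝓘(ℝ, E) 𝓘(ℝ, E) w.1
      (fun x => (e ⟨x, Y x⟩).2) : E → E) D (range 𝓘(ℝ, E)) (ψ w.1) :=
    (hsm.mdifferentiableAt (by simp)).hasMFDerivAt.2
  rw [modelWithCornersSelf_coe, range_id, hasFDerivWithinAt_univ] at hd
  -- The fibrewise linear map and the trivialization agree only over the base set, which suffices
  -- for derivatives.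
  have hev : η =ᶠ[nhds (ψ w.1)] writtenInExtChartAt 𝓘(ℝ, E) 𝓘(ℝ, E) w.1
      (fun x => (e ⟨x, Y x⟩).2) := by
    filter_upwards [eventually_symm_mem_source (mem_chart_source E w.1) w.1
      (mem_chart_source E w.1)] with y hy
    exact congrFun (Trivialization.coe_linearMapAt_of_mem (R := ℝ) e hy.2) _
  have hY := hd.congr_of_eventuallyEq hev
  have hval : η (ψ w.1) = (Y w.1 : E) := by
    have h : ψ.symm (ψ w.1) = w.1 := extChartAt_to_inv w.1
    refine (congrArg (fun z => e.continuousLinearMapAt ℝ z (Y z)) h).trans ?_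
    exact continuousLinearMapAt_self 𝓘(ℝ, E) w.1 (Y w.1)
  have h := flatLift_ι hY.differentiableAt (w.2 : E)
  rw [← hrep, hval, hY.fderiv] at h
  exact h

/-! ### The defining identity and uniqueness. -/

/-- The function defined by a multivector field on the manifold of covector tuples, in the
coordinates of a preferred chart. -/
theorem contraction_eq {r : ℕ} (X : MultivectorField 𝓘(ℝ, E) M) (p₀ p : CovectorTuples 𝓘(ℝ, E) M r)
    (hp : p.1 ∈ (chartAt E p₀.1).source) :
    contraction 𝓘(ℝ, E) r X p =
      pairing (extChartAt (𝓘(ℝ, E).prod 𝓘(ℝ, E →L[ℝ] (Fin r → ℝ))) p₀ p).2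
        (localRep X p₀.1
          (extChartAt (𝓘(ℝ, E).prod 𝓘(ℝ, E →L[ℝ] (Fin r → ℝ))) p₀ p).1) := by
  rw [extChartAt_covectorTuples, localRep_extChartAt X hp]
  refine congrArg (topCoeff r) ?_
  let e := trivializationAt E (TangentSpace 𝓘(ℝ, E) : M → Type _) p₀.1
  -- The trivialization followed by its inverse is inserted between the covectors and the
  -- multivector: their coordinate changes cancel.
  have h : (p.2.toLinearMap ∘ₗ (e.symmL ℝ p.1).toLinearMap) ∘ₗ
      (e.continuousLinearMapAt ℝ p.1).toLinearMap = p.2.toLinearMap :=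
    LinearMap.ext fun u => congrArg p.2 (e.symmL_continuousLinearMapAt hp u)
  have h2 := DFunLike.congr_fun (ExteriorAlgebra.map_comp_map
    (e.continuousLinearMapAt ℝ p.1).toLinearMap
    (p.2.toLinearMap ∘ₗ (e.symmL ℝ p.1).toLinearMap)) (X.1 p.1)
  rw [h] at h2
  exact h2.symm

theorem mfderiv_contraction {r : ℕ} (X : MultivectorField 𝓘(ℝ, E) M)
    {w : TangentBundle 𝓘(ℝ, E) M} (A : TangentSpace 𝓘(ℝ, E).tangent w →L[ℝ] (Fin r → ℝ)) :
    mfderiv (𝓘(ℝ, E).prod 𝓘(ℝ, E →L[ℝ] (Fin r → ℝ))) 𝓘(ℝ, ℝ) (contraction 𝓘(ℝ, E) r X)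
      (epsilonBase 𝓘(ℝ, E) A) =
    fderiv ℝ (fun q : E × (E →L[ℝ] (Fin r → ℝ)) => pairing q.2 (localRep X w.1 q.1))
      (extChartAt 𝓘(ℝ, E) w.1 w.1,
        (A : E × E →L[ℝ] (Fin r → ℝ)) ∘L ContinuousLinearMap.inr ℝ E E) := by
  let J := 𝓘(ℝ, E).prod 𝓘(ℝ, E →L[ℝ] (Fin r → ℝ))
  let p := epsilonBase 𝓘(ℝ, E) A
  let G : E × (E →L[ℝ] (Fin r → ℝ)) → ℝ := fun q => pairing q.2 (localRep X w.1 q.1)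
  have hG : DifferentiableAt ℝ G (extChartAt J p p) := by
    rw [extChartAt_epsilonBase]
    exact differentiableAt_pairing (differentiableAt_localRep X w.1) _
  have hsource : ∀ᶠ q in nhds p, contraction 𝓘(ℝ, E) r X q = G (extChartAt J p q) := by
    filter_upwards [(FiberBundle.continuous_proj (E →L[ℝ] (Fin r → ℝ))
      (fun x : M => TangentSpace 𝓘(ℝ, E) x →L[ℝ] Bundle.Trivial M (Fin r → ℝ) x)).continuousAt
      (x := p) |>.eventually ((chartAt E w.1).open_source.mem_nhds (mem_chart_source E w.1))]
      with q hq
    exact contraction_eq X p q hq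
  -- `HasMFDerivAt` requires continuity on the manifold in addition to a derivative in the chart.
  have hcont : ContinuousAt (contraction 𝓘(ℝ, E) r X) p :=
    (hG.continuousAt.comp (continuousAt_extChartAt p)).congr_of_eventuallyEq hsource
  have htarget : writtenInExtChartAt J 𝓘(ℝ, ℝ) p (contraction 𝓘(ℝ, E) r X)
      =ᶠ[nhds (extChartAt J p p)] G := by
    have h1 : ∀ᶠ q in nhds (extChartAt J p p), q ∈ (extChartAt J p).target :=
      extChartAt_target_mem_nhds p
    have h2 := continuousAt_extChartAt_symm (I := J) p
    rw [ContinuousAt, extChartAt_to_inv] at h2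
    filter_upwards [h1, h2.eventually hsource] with q hq1 hq2
    rw [(extChartAt J p).right_inv hq1] at hq2
    exact hq2
  have h : HasMFDerivAt J 𝓘(ℝ, ℝ) (contraction 𝓘(ℝ, E) r X) p
      (fderiv ℝ G (extChartAt J p p)) :=
    ⟨hcont, (hG.hasFDerivAt.congr_of_eventuallyEq htarget).hasFDerivWithinAt⟩
  rw [extChartAt_epsilonBase] at h
  exact h.mfderiv

/-- By definition `epsilon` is the pair of `w` and `A ∘ horiz`, which is the direction occurring in
`fderiv_pairing`. -/
theorem isTangentLift_tangentLift (X : MultivectorField 𝓘(ℝ, E) M) :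
    IsTangentLift 𝓘(ℝ, E) X (tangentLift X) := by
  intro r w A
  rw [mfderiv_contraction]
  exact (fderiv_pairing (differentiableAt_localRep X w.1) (w.2 : E)
    (A : E × E →L[ℝ] (Fin r → ℝ))).symm

theorem IsTangentLift.unique {X : MultivectorField 𝓘(ℝ, E) M}
    {Z Z' : MultivectorField 𝓘(ℝ, E).tangent (TangentBundle 𝓘(ℝ, E) M)}
    (h : IsTangentLift 𝓘(ℝ, E) X Z) (h' : IsTangentLift 𝓘(ℝ, E) X Z') : Z = Z' :=
  Subtype.ext <| funext fun w => ext_pairing (V := E × E) fun r A =>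
    (h r w A).trans (h' r w A).symm

end TangentLift

end Multivector

theorem theorem2p3 {E : Type*} [NormedAddCommGroup E] [NormedSpace ℝ E] [FiniteDimensional ℝ E]
    {M : Type*} [TopologicalSpace M] [ChartedSpace E M] [IsManifold 𝓘(ℝ, E) ∞ M] :
    ∃ dT : Multivector.MultivectorField 𝓘(ℝ, E) M →ₗ[ℝ]
        Multivector.MultivectorField 𝓘(ℝ, E).tangent (TangentBundle 𝓘(ℝ, E) M),
      (∀ X Z, Multivector.IsTangentLift 𝓘(ℝ, E) X Z ↔ Z = dT X) ∧
      Multivector.IsDerivationAlong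
        (Multivector.multivectorDegree 𝓘(ℝ, E) M)
        (Multivector.multivectorDegree 𝓘(ℝ, E).tangent (TangentBundle 𝓘(ℝ, E) M))
        (Multivector.verticalLift 𝓘(ℝ, E)) 0 dT ∧
      ∀ (Y : Cₛ^∞⟮𝓘(ℝ, E); E, (TangentSpace 𝓘(ℝ, E) : M → Type _)⟯)
        (w : TangentBundle 𝓘(ℝ, E) M),
        (dT (Multivector.ofVectorField 𝓘(ℝ, E) Y)).1 w =
          ExteriorAlgebra.ι ℝ (Multivector.completeLift 𝓘(ℝ, E) Y w) :=
  ⟨Multivector.tangentLift,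
    fun X _ => ⟨fun h => h.unique (Multivector.isTangentLift_tangentLift X),
      fun h => h ▸ Multivector.isTangentLift_tangentLift X⟩,
    Multivector.isDerivationAlong_tangentLift, Multivector.tangentLift_ofVectorField⟩
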